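/- **Setting.** Let $\mathcal H=L^2(\mathcal Z,\nu)$ be the real Hilbert space over a $\sigma$-finite measure space, assumed separable, with $\langle f,g\rangle=\int fg\,d\nu$; write $(v\otimes w)(x)=\langle v,x\rangle w$ and let $\|\cdot\|$ also denote the operator norm. Let the observations follow the local model $$X_i=\mu+\Delta_n\,g(i/n)+\varepsilon_i,\qquad i=1,\dots,n,$$ with $\mu,\Delta_n\in\mathcal H$ deterministic. *Change function.* $g:[0,1]\to\mathbb R$ is non-constant and bounded, $g(0)=0$, and $[0,1]$ can be partitioned into finitely many intervals of positive length on each of which $g$ is continuous (so $g$ is Riemann integrable). *Errors.* $(\varepsilon_i)_{i\in\mathbb Z}$ is a centered, strictly stationary sequence of random elements of $\mathcal H$ with $\mathsf E\|\varepsilon_1\|^k<\infty$ for some $k>2$. With $C_r=\mathsf E[\varepsilon_0\otimes\varepsilon_r]$ we have $\sum_{r\in\mathbb Z}\|C_r\|<\infty$ and $C_\varepsilon:=\sum_{r\in\mathbb Z}C_r\ne 0$, and there is an orthonormal basis $(v_{p,\varepsilon})_p$ of $\mathcal H$ with $C_\varepsilon=\sum_p\lambda_{p,\varepsilon}\,v_{p,\varepsilon}\otimes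 v_{p,\varepsilon}$ and $\sum_p\sum_{r\in\mathbb Z}|\mathsf{Cov}(\langle\varepsilon_0,v_{p,\varepsilon}\rangle,\langle\varepsilon_r,v_{p,\varepsilon}\rangle)|<\infty$. Moreover, $\{n^{-1/2}\sum_{i=1}^{\lfloor tn\rfloor}\varepsilon_i,\ t\in[0,1]\}$ converges weakly, in the Skorokhod space of càdlàg functions $[0,1]\to\mathcal H$, to an $\mathcal H$-valued Brownian motion with covariance operator $C_\varepsilon$. *Weight function.* $h:[-1,1]\to\mathbb R$ is non-constant and of bounded variation, $h(x)=0$ for $x\le 0$, and $|h(t)-h(s)|\le\beta|s-t|^\alpha$ for $s,t\in[0,1]$, for some $\alpha,\beta>0$. *Statistic.* Let $d\in\mathbb N$. Let $\hat C=\hat C_n$ be random bounded symmetric operators on $\mathcal H$ which almost surely have orthonormal eigenvectors $\hat v_1,\dots,\hat v_d$ belonging to their $d$ largest eigenvalues $\hat\lambda_1\ge\dots\ge\hat\lambda_d$ (counted with multiplicity), and assume that $\mathsf P(\hat\lambda_p\le 0)\to 0$ for $p=1,\dots,d$, so that the statistic is well defined with probability tending to one. With $\hat\eta_{i,p}=\langle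 X_i,\hat v_p\rangle$ and $\bar{\hat\eta}_{n,p}=\frac1n\sum_{i=1}^n\hat\eta_{i,p}$ let $$T_{n,\mathrm{PC}}(h)=\Bigg(\max_{1\le k<n}\ \sum_{p=1}^d\frac1{\hat\lambda_p}\,\frac1n\Big[\sum_{i=1}^n h\Big(\frac{i-k}n\Big)\big(\hat\eta_{i,p}-\bar{\hat\eta}_{n,p}\big)\Big]^2\Bigg)^{1/2}.$$ **Theorem (consistency of the gradual PCA test).** Suppose that $n\|\Delta_n\|^2\to\infty$ and that there are orthonormal $\tilde v_1,\dots,\tilde v_d\in\mathcal H$ such that, with $\tilde s_p=\operatorname{sgn}\langle\hat v_p,\tilde v_p\rangle$, $$\|\hat v_p-\tilde s_p\tilde v_p\|=o_P(1)\quad (p=1,\dots,d),\qquad \sum_{p=1}^d\langle\Delta_n,\tilde v_p\rangle^2\ge c\,\|\Delta_n\|^2\ \text{ for all } n\ge 1 \text{ and some } 0<c\le 1.$$ Suppose also that $\|\hat C\|=o_P(n\|\Delta_n\|^2)$ and that $$\sup_{0\le t\le 1}\left|\int_0^1h(x-t)\,g(x)\,dx-\int_0^1g(x)\,dx\int_0^1h(x-t)\,dx\right|>0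 .$$ Then $T_{n,\mathrm{PC}}(h)\to\infty$ in probability, that is, $\mathsf P(T_{n,\mathrm{PC}}(h)\le M)\to 0$ for every $M\in\mathbb R$. -/

import Mathlib

open MeasureTheory ProbabilityTheory Filter Topology
open scoped ENNReal NNReal unitInterval RealInnerProductSpace

noncomputable section

namespace GradualChange

/-! ### The Skorokhod space of càdlàg functions on the unit interval -/

/-- Right-continuous functions with left limits from `[0,1]` to `H`. -/
structure Cadlag (H : Type*) [TopologicalSpace H] where
  toFun : I → H
  right_cont : ∀ t, ContinuousWithinAt toFun (Set.Ici t) t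
  left_lim : ∀ t, ∃ l, Tendsto toFun (𝓝[<] t) (𝓝 l)

instance {H : Type*} [TopologicalSpace H] : CoeFun (Cadlag H) (fun _ => I → H) := ⟨Cadlag.toFun⟩

section Skorokhod

variable {H : Type*} [PseudoEMetricSpace H]

/-- The cost of matching `x` with `y` through the time change `τ` (an increasing bijection of
`[0,1]`): the maximum of `sup |τ t - t|` and `sup d(x t, y (τ t))`. -/
def skorokhodCost (x y : Cadlag H) (τ : I ≃o I) : ℝ≥0∞ :=
  max (⨆ t : I, edist (τ t) t) (⨆ t : I, edist (x t) (y (τ t)))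

/-- The Skorokhod distance. -/
def skorokhodDist (x y : Cadlag H) : ℝ≥0∞ := ⨅ τ : I ≃o I, skorokhodCost x y τ

theorem skorokhodDist_self (x : Cadlag H) : skorokhodDist x x = 0 := by
  refine le_antisymm ((iInf_le _ (OrderIso.refl I)).trans ?_) (zero_le)
  simp [skorokhodCost]

theorem skorokhodDist_comm_le (x y : Cadlag H) : skorokhodDist x y ≤ skorokhodDist y x := by
  refine le_iInf fun τ => (iInf_le _ τ.symm).trans ?_
  refine max_le_max (iSup_le fun t => ?_) (iSup_le fun t => ?_)
  · refine le_trans ?_ (le_iSup _ (τ.symm t))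
    rw [OrderIso.apply_symm_apply, edist_comm]
  · refine le_trans ?_ (le_iSup _ (τ.symm t))
    rw [OrderIso.apply_symm_apply, edist_comm]

theorem skorokhodDist_triangle (x y z : Cadlag H) :
    skorokhodDist x z ≤ skorokhodDist x y + skorokhodDist y z := by
  refine le_of_le_of_eq ?_ (ENNReal.iInf_add.symm)
  refine le_iInf fun τ => ?_
  unfold skorokhodDist
  rw [ENNReal.add_iInf]
  refine le_iInf fun ρ => (iInf_le _ (τ.trans ρ)).trans ?_
  refine max_le (iSup_le fun t => ?_) (iSup_le fun t => ?_)
  · rw [add_comm]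
    refine (edist_triangle _ (τ t) _).trans (add_le_add ?_ ?_)
    · exact (le_iSup (fun s : I => edist (ρ s) s) (τ t)).trans (le_max_left _ _)
    · exact (le_iSup (fun s : I => edist (τ s) s) t).trans (le_max_left _ _)
  · refine (edist_triangle _ (y (τ t)) _).trans (add_le_add ?_ ?_)
    · exact (le_iSup (fun s : I => edist (x s) (y (τ s))) t).trans (le_max_right _ _)
    · exact (le_iSup (fun s : I => edist (y s) (z (ρ s))) (τ t)).trans (le_max_right _ _)

/-- The Skorokhod (J1) topology, as the topology of the Skorokhod distance. -/
instance : PseudoEMetricSpace (Cadlag H) where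
  edist := skorokhodDist
  edist_self := skorokhodDist_self
  edist_comm x y := le_antisymm (skorokhodDist_comm_le x y) (skorokhodDist_comm_le y x)
  edist_triangle := skorokhodDist_triangle

/-- The Borel σ-algebra of the Skorokhod topology. -/
instance : MeasurableSpace (Cadlag H) := borel _

instance : BorelSpace (Cadlag H) := ⟨rfl⟩

end Skorokhod

section Hilbert

variable {H : Type*} [NormedAddCommGroup H] [InnerProductSpace ℝ H]

theorem tendsto_step_right {E : Type*} [TopologicalSpace E] (F : ℕ → E) (n : ℕ) (t : I) :
    Tendsto (fun s : I => F ⌊(s : ℝ) * n⌋₊) (𝓝[≥] t) (𝓝 (F ⌊(t : ℝ) * n⌋₊)) := by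
  have h1 : Tendsto (fun s : I => (s : ℝ) * n) (𝓝[≥] t) (𝓝[≥] ((t : ℝ) * n)) := by
    refine tendsto_nhdsWithin_iff.2 ⟨?_, ?_⟩
    · exact (Continuous.tendsto (by fun_prop) t).mono_left nhdsWithin_le_nhds
    · filter_upwards [self_mem_nhdsWithin] with s hs
      exact mul_le_mul_of_nonneg_right (show (t : ℝ) ≤ s from hs) (Nat.cast_nonneg n)
  have h2 := (tendsto_floor_right_pure_floor ((t : ℝ) * n)).comp h1
  have h3 : Tendsto (fun k : ℤ => F k.toNat) (pure ⌊(t : ℝ) * n⌋) (𝓝 (F ⌊(t : ℝ) * n⌋₊)) := by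
    rw [← Int.floor_toNat]
    exact (tendsto_pure_pure _ _).mono_right (pure_le_nhds _)
  refine (h3.comp h2).congr fun s => ?_
  simp [Int.floor_toNat]

theorem tendsto_step_left {E : Type*} [TopologicalSpace E] (F : ℕ → E) (n : ℕ) (t : I) :
    ∃ l, Tendsto (fun s : I => F ⌊(s : ℝ) * n⌋₊) (𝓝[<] t) (𝓝 l) := by
  rcases Nat.eq_zero_or_pos n with rfl | hn
  · exact ⟨F 0, by simpa using tendsto_const_nhds⟩
  have h1 : Tendsto (fun s : I => (s : ℝ) * n) (𝓝[<] t) (𝓝[<] ((t : ℝ) * n)) := by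
    refine tendsto_nhdsWithin_iff.2 ⟨?_, ?_⟩
    · exact (Continuous.tendsto (by fun_prop) t).mono_left nhdsWithin_le_nhds
    · filter_upwards [self_mem_nhdsWithin] with s hs
      exact mul_lt_mul_of_pos_right (show (s : ℝ) < t from hs) (by exact_mod_cast hn)
  have h2 := (tendsto_floor_left_pure_ceil_sub_one ((t : ℝ) * n)).comp h1
  have h3 : Tendsto (fun k : ℤ => F k.toNat) (pure (⌈(t : ℝ) * n⌉ - 1))
      (𝓝 (F (⌈(t : ℝ) * n⌉ - 1).toNat)) :=
    (tendsto_pure_pure _ _).mono_right (pure_le_nhds _)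
  refine ⟨_, (h3.comp h2).congr fun s => ?_⟩
  simp [Int.floor_toNat]

/-- The partial sum process `t ↦ n^{-1/2} ∑_{i=1}^{⌊tn⌋} e_i` as a càdlàg function. -/
def partialSumPath (e : ℤ → H) (n : ℕ) : Cadlag H where
  toFun t := (1 / √(n : ℝ)) • ∑ i ∈ Finset.Icc 1 ⌊(t : ℝ) * n⌋₊, e i
  right_cont t := tendsto_step_right (fun m => (1 / √(n : ℝ)) • ∑ i ∈ Finset.Icc 1 m, e i) n t
  left_lim t := tendsto_step_left (fun m => (1 / √(n : ℝ)) • ∑ i ∈ Finset.Icc 1 m, e i) n t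

/-- The tensor product `v ⊗ w`, i.e. the operator `x ↦ ⟨v, x⟩ w`. -/
def tensor (v w : H) : H →L[ℝ] H := InnerProductSpace.rankOne ℝ w v

variable {Ω : Type*} [MeasurableSpace Ω]

/-- The lag-`r` autocovariance operator `C_r = E[ε_0 ⊗ ε_r]`. -/
def autocov (P : Measure Ω) (ε : ℤ → Ω → H) (r : ℤ) : H →L[ℝ] H :=
  ∫ ω, tensor (ε 0 ω) (ε r ω) ∂P

/-- The long-run covariance operator `C_ε = ∑_{r ∈ ℤ} C_r`. -/
def longRunCov (P : Measure Ω) (ε : ℤ → Ω → H) : H →L[ℝ] H := ∑' r : ℤ, autocov P ε r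

/-- Strict stationarity: the law of the whole sequence is invariant under the unit time shift. -/
def IsStrictlyStationary [MeasurableSpace H] (P : Measure Ω) (ε : ℤ → Ω → H) : Prop :=
  IdentDistrib (fun ω (i : ℤ) => ε (i + 1) ω) (fun ω (i : ℤ) => ε i ω) P P

/-- The moment and dependence conditions on the errors. The spectral decomposition of the long-run
covariance operator is indexed by an arbitrary type `ι` (not by `ℕ` in the order of the
eigenvalues), so that a finite-dimensional `H` and a nontrivial kernel are covered too. -/
structure ErrorAssumption [MeasurableSpace H] (P : Measure Ω) (ε : ℤ → Ω → H) : Prop where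
  measurable : ∀ i, Measurable (ε i)
  stationary : IsStrictlyStationary P ε
  moment : ∃ k : ℝ, 2 < k ∧ MemLp (ε 1) (ENNReal.ofReal k) P
  centered : ∀ i, ∫ ω, ε i ω ∂P = 0
  summable_autocov : Summable fun r : ℤ => ‖autocov P ε r‖
  longRunCov_ne_zero : longRunCov P ε ≠ 0
  spectral : ∃ (ι : Type) (v : HilbertBasis ι ℝ H) (eigval : ι → ℝ),
    HasSum (fun p => eigval p • tensor (v p) (v p)) (longRunCov P ε) ∧
    Summable fun q : ι × ℤ =>
      |cov[fun ω => ⟪ε 0 ω, v q.1⟫, fun ω => ⟪ε q.2 ω, v q.1⟫; P]|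

/-- `W` is an `H`-valued Brownian motion on `[0,1]` with covariance operator `C`: it starts at `0`,
has continuous paths and independent increments, and `W t - W s` is centred Gaussian with
covariance operator `(t - s) C`. -/
structure IsHilbertBrownianMotion [MeasurableSpace H] (C : H →L[ℝ] H) (W : I → Ω → H)
    (P : Measure Ω) : Prop where
  aemeasurable : ∀ t, AEMeasurable (W t) P
  zero : ∀ᵐ ω ∂P, W 0 ω = 0
  continuous_paths : ∀ᵐ ω ∂P, Continuous fun t => W t ω
  indep_increments : HasIndepIncrements W P
  gaussian_increments : ∀ s t : I, s ≤ t → ∀ x : H,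
    HasLaw (fun ω => ⟪x, W t ω - W s ω⟫)
      (gaussianReal 0 (Real.toNNReal (((t : ℝ) - s) * ⟪C x, x⟫))) P

/-- The functional central limit theorem: weak convergence, in the Skorokhod space, of the
partial sum process of the errors to the Brownian motion `W` with covariance operator `C_ε`. -/
structure SatisfiesFCLT [MeasurableSpace H] {Ω' : Type*} [MeasurableSpace Ω']
    (P : Measure Ω) [IsProbabilityMeasure P] (ε : ℤ → Ω → H)
    (P' : Measure Ω') [IsProbabilityMeasure P'] (W : Ω' → Cadlag H) : Prop where
  brownian : IsHilbertBrownianMotion (longRunCov P ε) (fun t ω => W ω t) P'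
  tendsto : TendstoInDistribution (fun (n : ℕ) ω => partialSumPath (fun i => ε i ω) n) atTop W
    (fun _ => P) P'

/-- The local model `X_i = μ + Δ_n g(i/n) + ε_i`, `i = 1, …, n` (a triangular array). -/
def FollowsLocalModel (X : ℕ → ℕ → Ω → H) (μ : H) (Δ : ℕ → H) (g : ℝ → ℝ) (ε : ℤ → Ω → H) : Prop :=
  ∀ n i : ℕ, 1 ≤ i → i ≤ n → ∀ ω, X n i ω = μ + g ((i : ℝ) / n) • Δ n + ε i ω

/-- `v 0, v 1, …, v (d-1)` are orthonormal eigenvectors of the symmetric operator `C` belonging to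
its `d` largest eigenvalues `l 0 ≥ l 1 ≥ … ≥ l (d-1)`, counted with multiplicity. -/
structure IsLeadingEigensystem [CompleteSpace H] (C : H →L[ℝ] H) {d : ℕ} (l : Fin d → ℝ)
    (v : Fin d → H) : Prop where
  selfAdjoint : IsSelfAdjoint C
  orthonormal : Orthonormal ℝ v
  eigen : ∀ p, C (v p) = l p • v p
  antitone : Antitone l
  largest : ∀ (x : H) (κ : ℝ), x ≠ 0 → C x = κ • x → (∀ p, ⟪v p, x⟫ = 0) → ∀ p, κ ≤ l p

/-- The squared statistic
`max_{1 ≤ k < n} ∑_p (1/λ_p) (1/n) (∑_{i=1}^n h((i-k)/n) (η_{i,p} - mean of η_{·,p}))²`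
with the scores `η_{i,p} = ⟨x_i, v_p⟩` of the sample `x_1, …, x_n`. -/
def gradualPCSq (h : ℝ → ℝ) (n : ℕ) (x : ℕ → H) {d : ℕ} (l : Fin d → ℝ) (v : Fin d → H) : ℝ :=
  ⨆ k : Set.Ico 1 n, ∑ p : Fin d, 1 / l p * (1 / (n : ℝ)) *
    (∑ i ∈ Finset.Icc 1 n, h (((i : ℝ) - (k : ℕ)) / n) *
      (⟪x i, v p⟫ - 1 / (n : ℝ) * ∑ j ∈ Finset.Icc 1 n, ⟪x j, v p⟫)) ^ 2

/-- The PCA-based statistic for gradual changes. -/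
def gradualPC (h : ℝ → ℝ) (n : ℕ) (x : ℕ → H) {d : ℕ} (l : Fin d → ℝ) (v : Fin d → H) : ℝ :=
  √(gradualPCSq h n x l v)

end Hilbert

/-! ### Change functions, weight functions and the detectability condition -/

/-- The change function `g : [0,1] → ℝ` (values outside `[0,1]` are irrelevant): non-constant,
bounded, `g 0 = 0`, and piecewise continuous, i.e. `[0,1]` is partitioned into finitely many
intervals of positive length on each of which `g` is continuous. Such a function is Riemann
integrable. -/
structure IsChangeFunction (g : ℝ → ℝ) : Prop where
  nonconstant : ∃ x ∈ Set.Icc (0 : ℝ) 1, ∃ y ∈ Set.Icc (0 : ℝ) 1, g x ≠ g y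
  bounded : ∃ M : ℝ, ∀ x ∈ Set.Icc (0 : ℝ) 1, |g x| ≤ M
  zero : g 0 = 0
  piecewise_continuous : ∃ (m : ℕ) (J : Fin m → Set ℝ),
    (⋃ j, J j) = Set.Icc (0 : ℝ) 1 ∧ Pairwise (fun i j => Disjoint (J i) (J j)) ∧
    ∀ j, (J j).OrdConnected ∧ (J j).Nontrivial ∧ ContinuousOn g (J j)

/-- The weight function `h : [-1,1] → ℝ` (values outside `[-1,1]` are irrelevant). -/
structure IsWeightFunction (h : ℝ → ℝ) : Prop where
  nonconstant : ∃ x ∈ Set.Icc (-1 : ℝ) 1, ∃ y ∈ Set.Icc (-1 : ℝ) 1, h x ≠ h y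
  eq_zero : ∀ x ∈ Set.Icc (-1 : ℝ) 0, h x = 0
  bounded_variation : BoundedVariationOn h (Set.Icc (-1) 1)
  holder : ∃ α β : ℝ, 0 < α ∧ 0 < β ∧
    ∀ s ∈ Set.Icc (0 : ℝ) 1, ∀ t ∈ Set.Icc (0 : ℝ) 1, |h t - h s| ≤ β * |s - t| ^ α

/-- The signal term `∫₀¹ h(x-t) g(x) dx - ∫₀¹ g(x) dx ∫₀¹ h(x-t) dx`. -/
def signal (h g : ℝ → ℝ) (t : ℝ) : ℝ :=
  (∫ x in (0 : ℝ)..1, h (x - t) * g x) - (∫ x in (0 : ℝ)..1, g x) * ∫ x in (0 : ℝ)..1, h (x - t)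

/-- The detectability condition `sup_{0 ≤ t ≤ 1} |signal| > 0`. -/
def IsDetectable (h g : ℝ → ℝ) : Prop := 0 < ⨆ t : Set.Icc (0 : ℝ) 1, |signal h g t|

/-- The real random variables `T n` tend to infinity in probability. -/
def TendstoInfinityInProbability {Ω : Type*} [MeasurableSpace Ω] (P : Measure Ω)
    (T : ℕ → Ω → ℝ) : Prop :=
  ∀ M : ℝ, Tendsto (fun n => P {ω | T n ω ≤ M}) atTop (𝓝 0)

end GradualChange

end

open GradualChange

/-!
The maximum in the statistic is at least its term at any index `kₙ`. Take a point `t` at which the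
signal does not vanish and deterministic `kₙ` with `kₙ / n → t`. Centring the scores is the same as
centring the weights, so the `p`-th sum at `kₙ` is `⟪Sₙ Δₙ + Nₙ, v̂_p⟫` with a number `Sₙ` and a
random element `Nₙ` of the Hilbert space that do not depend on `p`
(`sum_centeredWeight_mul_inner`).

* The number `Sₙ / n` is a Riemann sum that converges to the signal at `t`
  (`tendsto_sum_centeredWeight_mul`): the weight function is continuous on `[-1,1]`, and the change
  function is continuous off the endpoints of its pieces, so dominated convergence applies.
* The noise `Nₙ` satisfies `E ‖Nₙ‖² = O(n)`
  (`ErrorAssumption.exists_lintegral_sq_norm_sum_le`). Expanding in the eigenbasis of the long-run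
  covariance operator, each coordinate contributes at most a constant times `n` times the sum of its
  absolute autocovariances, and these are summable over the basis. This bounds the noise in the norm
  of the whole space, so the dependence between the estimated eigenvectors and the errors is
  irrelevant, and at a single deterministic index no functional limit theorem is needed. Markov's
  inequality and `n ‖Δₙ‖² → ∞` give `‖Nₙ‖² = o_P(n² ‖Δₙ‖²)`.
* Since the `v̂_p` are close to `± v'_p`, the sum of the `⟪Δₙ, v̂_p⟫²` is at least `c ‖Δₙ‖² / 4`, and
  Bessel's inequality bounds the noise contribution by `‖Nₙ‖²`.

As `λ̂_p ≤ ‖Ĉ‖`, the squared statistic is with high probability at least a constant times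
`n ‖Δₙ‖² / ‖Ĉ‖` (`le_gradualPCSq_of_signal_of_noise`), which tends to infinity in probability.
-/

namespace GradualChange

/-! ### Riemann sums of triangular arrays -/

theorem intervalIntegral_ceil_eq_sum (F : ℕ → ℝ) {n : ℕ} (hn : 0 < n) :
    ∫ x in (0 : ℝ)..1, F ⌈(n : ℝ) * x⌉₊ = 1 / (n : ℝ) * ∑ i ∈ Finset.Icc 1 n, F i := by
  have hn' : (0 : ℝ) < n := by exact_mod_cast hn
  have hcell : ∀ k : ℕ, Set.EqOn (fun _ => F (k + 1)) (fun x : ℝ => F ⌈(n : ℝ) * x⌉₊)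
      (Set.uIoc ((k : ℝ) / n) (((k + 1 : ℕ) : ℝ) / n)) := by
    intro k x hx
    rw [Set.uIoc_of_le (by gcongr; simp)] at hx
    have h1 : ⌈(n : ℝ) * x⌉₊ = k + 1 := by
      rw [Nat.ceil_eq_iff (by simp)]
      constructor
      · have := hx.1
        rw [div_lt_iff₀ hn'] at this
        simpa [mul_comm] using this
      · have := hx.2
        rw [le_div_iff₀ hn'] at this
        simpa [mul_comm] using this
    simp [h1]
  have hint : ∀ k < n, IntervalIntegrable (fun x : ℝ => F ⌈(n : ℝ) * x⌉₊) volume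
      ((k : ℝ) / n) (((k + 1 : ℕ) : ℝ) / n) := fun k _ =>
    (intervalIntegrable_const (μ := volume) (c := F (k + 1))).congr (hcell k)
  have hsum := intervalIntegral.sum_integral_adjacent_intervals (a := fun k : ℕ => (k : ℝ) / n) hint
  simp only [Nat.cast_zero, zero_div, div_self hn'.ne'] at hsum
  rw [← hsum, Finset.mul_sum]
  have hr : Finset.Icc 1 n = (Finset.range n).image (· + 1) := by
    ext i
    simp only [Finset.mem_Icc, Finset.mem_image, Finset.mem_range]
    constructor
    · intro h; exact ⟨i - 1, by omega, by omega⟩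
    · rintro ⟨a, ha, rfl⟩; omega
  rw [hr, Finset.sum_image (by intro a _ b _ h; simpa using h)]
  refine Finset.sum_congr rfl fun k _ => ?_
  have h2 : ∫ x in ((k : ℝ) / n)..(((k + 1 : ℕ) : ℝ) / n), F ⌈(n : ℝ) * x⌉₊ =
      ∫ _ in ((k : ℝ) / n)..(((k + 1 : ℕ) : ℝ) / n), F (k + 1) :=
    intervalIntegral.integral_congr_ae (Eventually.of_forall fun x hx => (hcell k hx).symm)
  rw [h2, intervalIntegral.integral_const, smul_eq_mul]
  push_cast
  ring

/-- Dominated convergence for averages of a triangular array: the average of row `n` is the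
integral of the step function `x ↦ F n ⌈n x⌉`. -/
theorem tendsto_average_of_tendsto_ceil (F : ℕ → ℕ → ℝ) (φ : ℝ → ℝ) (B : ℝ)
    (hB : ∀ᶠ n in atTop, ∀ i ∈ Finset.Icc 1 n, |F n i| ≤ B)
    (hlim : ∀ᵐ x : ℝ, x ∈ Set.Ioc (0 : ℝ) 1 →
      Tendsto (fun n : ℕ => F n ⌈(n : ℝ) * x⌉₊) atTop (𝓝 (φ x))) :
    Tendsto (fun n : ℕ => 1 / (n : ℝ) * ∑ i ∈ Finset.Icc 1 n, F n i) atTop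
      (𝓝 (∫ x in (0 : ℝ)..1, φ x)) := by
  have key : Tendsto (fun n : ℕ => ∫ x in (0 : ℝ)..1, F n ⌈(n : ℝ) * x⌉₊) atTop
      (𝓝 (∫ x in (0 : ℝ)..1, φ x)) := by
    refine intervalIntegral.tendsto_integral_filter_of_dominated_convergence (fun _ => B) ?_ ?_
      intervalIntegrable_const ?_
    · refine Eventually.of_forall fun n => Measurable.aestronglyMeasurable ?_
      exact (measurable_of_countable (F n)).comp (Nat.measurable_ceil.comp (by fun_prop))
    · filter_upwards [hB, eventually_gt_atTop 0] with n hn h0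
      refine Eventually.of_forall fun x hx => ?_
      rw [Set.uIoc_of_le zero_le_one] at hx
      rw [Real.norm_eq_abs]
      have hn' : (0 : ℝ) < n := by exact_mod_cast h0
      refine hn _ (Finset.mem_Icc.2 ⟨?_, ?_⟩)
      · exact Nat.ceil_pos.2 (mul_pos hn' hx.1)
      · rw [Nat.ceil_le]
        nlinarith [hx.2]
    · rwa [Set.uIoc_of_le zero_le_one]
  refine key.congr' ?_
  filter_upwards [eventually_gt_atTop 0] with n hn
  exact intervalIntegral_ceil_eq_sum (F n) hn

/-! ### Weight and change functions -/

theorem IsWeightFunction.continuousOn {h : ℝ → ℝ} (hh : IsWeightFunction h) :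
    ContinuousOn h (Set.Icc (-1) 1) := by
  obtain ⟨α, β, hα, hβ, hol⟩ := hh.holder
  have h1 : ContinuousOn h (Set.Icc (-1) 0) :=
    continuousOn_const.congr (f := fun _ => (0 : ℝ)) hh.eq_zero
  have h2 : ContinuousOn h (Set.Icc 0 1) := by
    intro s hs
    have h3 : Tendsto (fun t => β * |s - t| ^ α) (𝓝[Set.Icc 0 1] s) (𝓝 0) := by
      have hc : Continuous fun t => β * |s - t| ^ α := by
        have : Continuous fun t => |s - t| := by fun_prop
        exact continuous_const.mul (this.rpow_const fun _ => Or.inr hα.le)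
      have := hc.tendsto s
      simp only [sub_self, abs_zero, Real.zero_rpow hα.ne', mul_zero] at this
      exact this.mono_left nhdsWithin_le_nhds
    refine tendsto_iff_norm_sub_tendsto_zero.2 (squeeze_zero' (Eventually.of_forall fun _ =>
      norm_nonneg _) ?_ h3)
    filter_upwards [self_mem_nhdsWithin] with t ht
    exact hol s hs t ht
  have h4 : Set.Icc (-1 : ℝ) 1 = Set.Icc (-1) 0 ∪ Set.Icc 0 1 :=
    (Set.Icc_union_Icc_eq_Icc (by norm_num) (by norm_num)).symm
  rw [h4]
  exact h1.union_of_isClosed h2 isClosed_Icc isClosed_Icc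

theorem IsWeightFunction.bounded {h : ℝ → ℝ} (hh : IsWeightFunction h) :
    ∃ B : ℝ, 0 < B ∧ ∀ x ∈ Set.Icc (-1 : ℝ) 1, |h x| ≤ B := by
  obtain ⟨B, hB⟩ := isCompact_Icc.exists_bound_of_continuousOn hh.continuousOn
  exact ⟨max B 1, by positivity, fun x hx => (hB x hx).trans (le_max_left _ _)⟩

theorem IsChangeFunction.ae_continuousAt {g : ℝ → ℝ} (hg : IsChangeFunction g) :
    ∀ᵐ x : ℝ, x ∈ Set.Ioc (0 : ℝ) 1 → ContinuousAt g x := by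
  obtain ⟨m, J, hJ, -, hJc⟩ := hg.piecewise_continuous
  have h1 : ∀ᵐ x : ℝ, ∀ j, x ∉ frontier (J j) := by
    rw [ae_all_iff]
    exact fun j => measure_eq_zero_iff_ae_notMem.1 ((hJc j).1.convex.addHaar_frontier volume)
  filter_upwards [h1] with x hx hx01
  have hxJ : x ∈ ⋃ j, J j := by rw [hJ]; exact ⟨hx01.1.le, hx01.2⟩
  obtain ⟨j, hj⟩ := Set.mem_iUnion.1 hxJ
  have hint : x ∈ interior (J j) := by
    by_contra hcon
    exact hx j ⟨subset_closure hj, hcon⟩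
  exact (hJc j).2.2.continuousAt (mem_interior_iff_mem_nhds.1 hint)

/-! ### Convergence of the normalised signal -/

/-- The centred weight `h((i-k)/n) - n⁻¹ ∑ⱼ h((j-k)/n)` of the `i`-th observation when the
candidate change point is `k`. -/
noncomputable def centeredWeight (h : ℝ → ℝ) (n k i : ℕ) : ℝ :=
  h (((i : ℝ) - k) / n) - 1 / (n : ℝ) * ∑ j ∈ Finset.Icc 1 n, h (((j : ℝ) - k) / n)

theorem sub_div_mem_Icc {n k i : ℕ} (hk : k ≤ n) (hi : i ≤ n) :
    ((i : ℝ) - k) / n ∈ Set.Icc (-1 : ℝ) 1 := by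
  rcases Nat.eq_zero_or_pos n with rfl | hn
  · simp
  have hn' : (0 : ℝ) < n := by exact_mod_cast hn
  have hk' : (k : ℝ) ≤ n := by exact_mod_cast hk
  have hi' : (i : ℝ) ≤ n := by exact_mod_cast hi
  have := Nat.cast_nonneg (α := ℝ) i
  have := Nat.cast_nonneg (α := ℝ) k
  constructor
  · rw [le_div_iff₀ hn']; linarith
  · rw [div_le_iff₀ hn']; linarith

theorem abs_centeredWeight_le {h : ℝ → ℝ} {B : ℝ} (hB : ∀ x ∈ Set.Icc (-1 : ℝ) 1, |h x| ≤ B)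
    {n k i : ℕ} (hn : 0 < n) (hk : k ≤ n) (hi : i ≤ n) : |centeredWeight h n k i| ≤ 2 * B := by
  have hn' : (0 : ℝ) < n := by exact_mod_cast hn
  have h1 := hB _ (sub_div_mem_Icc hk hi)
  have h2 : |1 / (n : ℝ) * ∑ j ∈ Finset.Icc 1 n, h (((j : ℝ) - k) / n)| ≤ B := by
    rw [abs_mul, abs_of_pos (by positivity : 0 < 1 / (n : ℝ)), one_div, inv_mul_le_iff₀ hn']
    refine (Finset.abs_sum_le_sum_abs _ _).trans ((Finset.sum_le_card_nsmul _ _ B ?_).trans ?_)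
    · exact fun j hj => hB _ (sub_div_mem_Icc hk (Finset.mem_Icc.1 hj).2)
    · simp
  calc |centeredWeight h n k i| ≤ _ + _ := abs_sub _ _
    _ ≤ 2 * B := by linarith

theorem sum_mul_sub_average (w x : ℕ → ℝ) (n : ℕ) :
    ∑ i ∈ Finset.Icc 1 n, w i * (x i - 1 / (n : ℝ) * ∑ j ∈ Finset.Icc 1 n, x j) =
      ∑ i ∈ Finset.Icc 1 n, (w i - 1 / (n : ℝ) * ∑ j ∈ Finset.Icc 1 n, w j) * x i := by
  simp only [mul_sub, sub_mul, Finset.sum_sub_distrib, ← Finset.sum_mul, ← Finset.mul_sum]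
  ring

theorem sum_centeredWeight (h : ℝ → ℝ) {n : ℕ} (hn : 0 < n) (k : ℕ) :
    ∑ i ∈ Finset.Icc 1 n, centeredWeight h n k i = 0 := by
  have hn' : (n : ℝ) ≠ 0 := by positivity
  simp only [centeredWeight, Finset.sum_sub_distrib, Finset.sum_const, Nat.card_Icc,
    Nat.add_sub_cancel, nsmul_eq_mul]
  field_simp
  ring

theorem tendsto_ceil_mul_div (x : ℝ) (hx : 0 ≤ x) :
    Tendsto (fun n : ℕ => (⌈(n : ℝ) * x⌉₊ : ℝ) / n) atTop (𝓝 x) := by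
  simpa [mul_comm, Function.comp_def] using
    (tendsto_nat_ceil_mul_div_atTop hx).comp tendsto_natCast_atTop_atTop

/-- If `kₙ / n → t`, the normalised deterministic part of the statistic at `kₙ` converges to the
signal at `t`. -/
theorem tendsto_sum_centeredWeight_mul {h g : ℝ → ℝ} (hh : IsWeightFunction h)
    (hg : IsChangeFunction g) {t : ℝ} (ht : t ∈ Set.Icc (0 : ℝ) 1) {k : ℕ → ℕ}
    (hk : ∀ᶠ n in atTop, k n ≤ n)
    (hkt : Tendsto (fun n => (k n : ℝ) / n) atTop (𝓝 t)) :
    Tendsto (fun n : ℕ => 1 / (n : ℝ) *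
      ∑ i ∈ Finset.Icc 1 n, centeredWeight h n (k n) i * g ((i : ℝ) / n)) atTop
      (𝓝 (signal h g t)) := by
  obtain ⟨B, hB0, hB⟩ := hh.bounded
  obtain ⟨M, hM⟩ := hg.bounded
  have hgb : ∀ n : ℕ, ∀ i ∈ Finset.Icc 1 n, |g ((i : ℝ) / n)| ≤ M := by
    intro n i hi
    refine hM _ ⟨by positivity, div_le_one_of_le₀ ?_ (Nat.cast_nonneg n)⟩
    exact_mod_cast (Finset.mem_Icc.1 hi).2
  have hhb : ∀ᶠ n : ℕ in atTop, ∀ i ∈ Finset.Icc 1 n, |h (((i : ℝ) - k n) / n)| ≤ B := by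
    filter_upwards [hk] with n hn i hi
    exact hB _ (sub_div_mem_Icc hn (Finset.mem_Icc.1 hi).2)
  have hglim : ∀ᵐ x : ℝ, x ∈ Set.Ioc (0 : ℝ) 1 →
      Tendsto (fun n : ℕ => g ((⌈(n : ℝ) * x⌉₊ : ℝ) / n)) atTop (𝓝 (g x)) := by
    filter_upwards [hg.ae_continuousAt] with x hx hx01
    exact (hx hx01).tendsto.comp (tendsto_ceil_mul_div x hx01.1.le)
  have hhlim : ∀ᵐ x : ℝ, x ∈ Set.Ioc (0 : ℝ) 1 →
      Tendsto (fun n : ℕ => h (((⌈(n : ℝ) * x⌉₊ : ℝ) - k n) / n)) atTop (𝓝 (h (x - t))) := by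
    filter_upwards [Measure.ae_ne volume (1 : ℝ)] with x hx1 hx01
    have hlt : x < 1 := lt_of_le_of_ne hx01.2 hx1
    have hc : ContinuousAt h (x - t) := hh.continuousOn.continuousAt
      (Icc_mem_nhds (by linarith [hx01.1, ht.2]) (by linarith [ht.1]))
    refine hc.tendsto.comp ?_
    simpa only [sub_div] using (tendsto_ceil_mul_div x hx01.1.le).sub hkt
  have l1 := tendsto_average_of_tendsto_ceil (fun n i => h (((i : ℝ) - k n) / n) * g ((i : ℝ) / n))
    (fun x => h (x - t) * g x) (B * M) (by
      filter_upwards [hhb] with n hn i hi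
      rw [abs_mul]
      exact mul_le_mul (hn i hi) (hgb n i hi) (abs_nonneg _) hB0.le) (by
      filter_upwards [hglim, hhlim] with x h1 h2 hx
      exact (h2 hx).mul (h1 hx))
  have l2 := tendsto_average_of_tendsto_ceil (fun n i => h (((i : ℝ) - k n) / n))
    (fun x => h (x - t)) B hhb hhlim
  have l3 := tendsto_average_of_tendsto_ceil (fun n i => g ((i : ℝ) / n)) g M
    (Eventually.of_forall hgb) hglim
  refine (l1.sub (l3.mul l2)).congr fun n => ?_
  simp only [centeredWeight, sub_mul, Finset.sum_sub_distrib, ← Finset.mul_sum]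
  ring

theorem exists_tendsto_div {t : ℝ} (ht : t ∈ Set.Icc (0 : ℝ) 1) :
    ∃ k : ℕ → ℕ, (∀ n, 2 ≤ n → 1 ≤ k n ∧ k n < n) ∧
      Tendsto (fun n => (k n : ℝ) / n) atTop (𝓝 t) := by
  refine ⟨fun n => 1 + ⌊t * (n - 2 : ℕ)⌋₊, fun n hn => ⟨Nat.le_add_right _ _, ?_⟩, ?_⟩
  · have h1 : ⌊t * (n - 2 : ℕ)⌋₊ ≤ n - 2 := Nat.floor_le_of_le
      (mul_le_of_le_one_left (Nat.cast_nonneg _) ht.2)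
    show 1 + ⌊t * (n - 2 : ℕ)⌋₊ < n
    omega
  · have h0 : Tendsto (fun n : ℕ => 2 / (n : ℝ)) atTop (𝓝 0) :=
      tendsto_const_div_atTop_nhds_zero_nat 2
    refine tendsto_iff_norm_sub_tendsto_zero.2 (squeeze_zero' (Eventually.of_forall fun _ =>
      norm_nonneg _) ?_ h0)
    filter_upwards [eventually_ge_atTop 2] with n hn
    have hn' : (0 : ℝ) < n := by positivity
    have h1 := Nat.floor_le (mul_nonneg ht.1 (Nat.cast_nonneg (α := ℝ) (n - 2)))
    have h2 := Nat.lt_floor_add_one (t * ((n - 2 : ℕ) : ℝ))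
    rw [Nat.cast_sub hn] at h1 h2
    push_cast at h1 h2 ⊢
    rw [Nat.cast_sub hn]
    push_cast
    rw [Real.norm_eq_abs, div_sub' hn'.ne', abs_div, abs_of_pos hn']
    gcongr
    rw [abs_le]
    constructor <;> nlinarith [ht.1, ht.2]

theorem IsDetectable.exists_signal_ne_zero {h g : ℝ → ℝ} (hd : IsDetectable h g) :
    ∃ t ∈ Set.Icc (0 : ℝ) 1, signal h g t ≠ 0 := by
  obtain ⟨t, ht⟩ := exists_lt_of_lt_ciSup hd
  exact ⟨t, t.2, abs_pos.1 ht⟩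

/-! ### Second moments of weighted sums of errors -/

section Noise

variable {H : Type*} [NormedAddCommGroup H] [InnerProductSpace ℝ H]

/-- An orthonormal family in a separable space is countable, since the balls of radius `1/2` around
its members are disjoint. -/
theorem countable_of_orthonormal [SecondCountableTopology H] {ι : Type*} {b : ι → H}
    (hb : Orthonormal ℝ b) : Countable ι := by
  refine Pairwise.countable_of_isOpen_disjoint (s := fun p => Metric.ball (b p) (1 / 2)) ?_
    (fun _ => Metric.isOpen_ball) (fun p => ⟨b p, Metric.mem_ball_self (by norm_num)⟩)
  intro p q hpq
  refine Metric.ball_disjoint_ball ?_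
  have h1 : ‖b p - b q‖ ^ 2 = 2 := by
    rw [norm_sub_sq_real, hb.1, hb.1, hb.2 hpq]
    norm_num
  rw [dist_eq_norm]
  nlinarith [norm_nonneg (b p - b q)]

variable [MeasurableSpace H] [BorelSpace H]
variable {Ω : Type*} [MeasurableSpace Ω] {P : Measure Ω} {ε : ℤ → Ω → H}

theorem ErrorAssumption.memLp_two [IsProbabilityMeasure P] (hε : ErrorAssumption P ε) (i : ℤ) :
    MemLp (ε i) 2 P := by
  have hstep : ∀ j, MemLp (ε (j + 1)) 2 P ↔ MemLp (ε j) 2 P := fun j =>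
    (hε.stationary.comp (measurable_pi_apply j)).memLp_iff
  have h1 : MemLp (ε 1) 2 P := by
    obtain ⟨k, hk, hm⟩ := hε.moment
    refine hm.mono_exponent ?_
    rw [show (2 : ℝ≥0∞) = ENNReal.ofReal 2 by simp]
    exact ENNReal.ofReal_le_ofReal hk.le
  induction i using Int.induction_on with
  | zero => exact (hstep 0).1 h1
  | succ i ih => exact (hstep _).2 ih
  | pred i ih => exact (hstep _).1 (by simpa using ih)

theorem ErrorAssumption.memLp_inner [IsProbabilityMeasure P] (hε : ErrorAssumption P ε) (i : ℤ)
    (x : H) : MemLp (fun ω => ⟪ε i ω, x⟫) 2 P :=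
  (hε.memLp_two i).inner_const x

variable [SecondCountableTopology H]

/-- By stationarity and centering, `E ⟨ε_i, x⟩⟨ε_j, x⟩` is the lag `j - i` autocovariance of the
coordinate sequence. -/
theorem ErrorAssumption.integral_inner_mul_inner [CompleteSpace H] [IsProbabilityMeasure P]
    (hε : ErrorAssumption P ε) (i j : ℤ) (x : H) :
    ∫ ω, ⟪ε i ω, x⟫ * ⟪ε j ω, x⟫ ∂P =
      cov[fun ω => ⟪ε 0 ω, x⟫, fun ω => ⟪ε (j - i) ω, x⟫; P] := by
  have hcent : ∀ i, ∫ ω, ⟪ε i ω, x⟫ ∂P = 0 := fun i => by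
    have h1 := integral_inner ((hε.memLp_two i).integrable (by norm_num)) x (𝕜 := ℝ)
    rw [hε.centered i, inner_zero_right] at h1
    simpa only [real_inner_comm] using h1
  have hstep : ∀ i j : ℤ, ∫ ω, ⟪ε (i + 1) ω, x⟫ * ⟪ε (j + 1) ω, x⟫ ∂P =
      ∫ ω, ⟪ε i ω, x⟫ * ⟪ε j ω, x⟫ ∂P := fun i j => by
    have hu : Measurable fun e : ℤ → H => ⟪e i, x⟫ * ⟪e j, x⟫ := by fun_prop
    exact (hε.stationary.comp hu).integral_eq
  have hall : ∀ i r : ℤ, ∫ ω, ⟪ε i ω, x⟫ * ⟪ε (r + i) ω, x⟫ ∂P =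
      ∫ ω, ⟪ε 0 ω, x⟫ * ⟪ε r ω, x⟫ ∂P := fun i r => by
    induction i using Int.induction_on with
    | zero => simp
    | succ i ih => rw [← ih, ← hstep i (r + i), add_assoc r]
    | pred i ih =>
      rw [← ih, ← hstep, add_assoc, sub_add_cancel]
  rw [covariance_eq_sub (hε.memLp_inner _ x) (hε.memLp_inner _ x), hcent, zero_mul, sub_zero]
  simpa using hall i (j - i)

theorem ErrorAssumption.integral_sq_inner_sum_le [CompleteSpace H] [IsProbabilityMeasure P]
    (hε : ErrorAssumption P ε) (x : H)
    (hs : Summable fun r : ℤ => |cov[fun ω => ⟪ε 0 ω, x⟫, fun ω => ⟪ε r ω, x⟫; P]|)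
    (n : ℕ) (a : ℕ → ℝ) {A : ℝ} (ha : ∀ i ∈ Finset.Icc 1 n, |a i| ≤ A) :
    ∫ ω, ⟪∑ i ∈ Finset.Icc 1 n, a i • ε i ω, x⟫ ^ 2 ∂P ≤
      n * A ^ 2 * ∑' r : ℤ, |cov[fun ω => ⟪ε 0 ω, x⟫, fun ω => ⟪ε r ω, x⟫; P]| := by
  set γ : ℤ → ℝ := fun r => |cov[fun ω => ⟪ε 0 ω, x⟫, fun ω => ⟪ε r ω, x⟫; P]| with hγ
  have hexp : ∀ ω, ⟪∑ i ∈ Finset.Icc 1 n, a i • ε i ω, x⟫ ^ 2 =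
      ∑ i ∈ Finset.Icc 1 n, ∑ j ∈ Finset.Icc 1 n,
        a i * a j * (⟪ε i ω, x⟫ * ⟪ε j ω, x⟫) := fun ω => by
    rw [sq, sum_inner, Finset.sum_mul_sum]
    refine Finset.sum_congr rfl fun i _ => Finset.sum_congr rfl fun j _ => ?_
    rw [real_inner_smul_left, real_inner_smul_left]
    ring
  have hint : ∀ i j : ℕ, Integrable (fun ω => a i * a j * (⟪ε i ω, x⟫ * ⟪ε j ω, x⟫)) P :=
    fun i j => ((hε.memLp_inner i x).integrable_mul (hε.memLp_inner j x)).const_mul _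
  simp_rw [hexp]
  rw [integral_finsetSum _ fun i _ => integrable_finsetSum _ fun j _ => hint i j]
  have hrow : ∀ i ∈ Finset.Icc 1 n, ∫ ω, ∑ j ∈ Finset.Icc 1 n,
      a i * a j * (⟪ε i ω, x⟫ * ⟪ε j ω, x⟫) ∂P ≤ A ^ 2 * ∑' r, γ r := fun i hi => by
    rw [integral_finsetSum _ fun j _ => hint i j]
    have h1 : ∀ j ∈ Finset.Icc 1 n, ∫ ω, a i * a j * (⟪ε i ω, x⟫ * ⟪ε j ω, x⟫) ∂P ≤
        A ^ 2 * γ ((j : ℤ) - i) := fun j hj => by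
      rw [integral_const_mul, hε.integral_inner_mul_inner]
      refine (le_abs_self _).trans ?_
      rw [abs_mul, abs_mul, sq]
      have := (abs_nonneg _).trans (ha i hi)
      exact mul_le_mul_of_nonneg_right (mul_le_mul (ha i hi) (ha j hj) (abs_nonneg _) this)
        (abs_nonneg _)
    refine (Finset.sum_le_sum h1).trans ?_
    rw [← Finset.mul_sum]
    refine mul_le_mul_of_nonneg_left ?_ (sq_nonneg A)
    have hinj : Function.Injective fun j : ℕ => (j : ℤ) - i := fun p q hpq => by
      simpa using hpq
    rw [← Finset.sum_image (s := Finset.Icc 1 n) (f := γ) hinj.injOn]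
    exact hs.sum_le_tsum _ fun r _ => abs_nonneg _
  refine (Finset.sum_le_card_nsmul _ _ _ hrow).trans_eq ?_
  simp [mul_assoc]

/-- Weighted sums of `n` errors with bounded weights have second moment of order `n`. The trace of
their covariance is computed in the eigenbasis of the long-run covariance operator, where the
autocovariances are absolutely summable over coordinates and lags together. -/
theorem ErrorAssumption.exists_lintegral_sq_norm_sum_le [CompleteSpace H] [IsProbabilityMeasure P]
    (hε : ErrorAssumption P ε) :
    ∃ K : ℝ, 0 ≤ K ∧ ∀ (n : ℕ) (a : ℕ → ℝ) (A : ℝ), (∀ i ∈ Finset.Icc 1 n, |a i| ≤ A) →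
      ∫⁻ ω, ENNReal.ofReal (‖∑ i ∈ Finset.Icc 1 n, a i • ε i ω‖ ^ 2) ∂P ≤
        ENNReal.ofReal (n * A ^ 2 * K) := by
  obtain ⟨ι, b, -, -, hsum⟩ := hε.spectral
  have : Countable ι := countable_of_orthonormal b.orthonormal
  set c : ι → ℤ → ℝ := fun p r =>
    |cov[fun ω => ⟪ε 0 ω, b p⟫, fun ω => ⟪ε r ω, b p⟫; P]| with hc
  have hrow : ∀ p, Summable (c p) := fun p => hsum.prod_factor p
  have htot : Summable fun p => ∑' r, c p r := hsum.prod
  have hnn : ∀ p, 0 ≤ ∑' r, c p r := fun p => tsum_nonneg fun r => abs_nonneg _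
  refine ⟨∑' p, ∑' r, c p r, tsum_nonneg hnn, fun n a A ha => ?_⟩
  set N : Ω → H := fun ω => ∑ i ∈ Finset.Icc 1 n, a i • ε i ω with hN
  have hNL : MemLp N 2 P := memLp_finsetSum _ fun i _ => (hε.memLp_two i).const_smul (a i)
  have hparseval : ∀ ω, ENNReal.ofReal (‖N ω‖ ^ 2) = ∑' p, ENNReal.ofReal (⟪N ω, b p⟫ ^ 2) := by
    intro ω
    have h1 := b.hasSum_inner_mul_inner (N ω) (N ω)
    simp only [real_inner_self_eq_norm_sq, real_inner_comm (N ω), ← sq] at h1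
    rw [← h1.tsum_eq, ENNReal.ofReal_tsum_of_nonneg (fun p => sq_nonneg _) h1.summable]
  have hNm : Measurable N := by
    have := hε.measurable
    fun_prop
  calc ∫⁻ ω, ENNReal.ofReal (‖N ω‖ ^ 2) ∂P
      = ∑' p, ∫⁻ ω, ENNReal.ofReal (⟪N ω, b p⟫ ^ 2) ∂P := by
        simp_rw [hparseval]
        exact lintegral_tsum fun p => by fun_prop
    _ ≤ ∑' p, ENNReal.ofReal (n * A ^ 2 * ∑' r, c p r) := by
        refine ENNReal.tsum_le_tsum fun p => ?_
        rw [← ofReal_integral_eq_lintegral_ofReal (hNL.inner_const (b p)).integrable_sq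
          (Eventually.of_forall fun _ => sq_nonneg _)]
        exact ENNReal.ofReal_le_ofReal (hε.integral_sq_inner_sum_le (b p) (hrow p) n a ha)
    _ = ENNReal.ofReal (n * A ^ 2 * ∑' p, ∑' r, c p r) := by
        rw [← tsum_mul_left, ENNReal.ofReal_tsum_of_nonneg
          (fun p => mul_nonneg (by positivity) (hnn p)) (htot.mul_left _)]

/-- Weighted sums of `n` errors are negligible at the rate `n ‖Δₙ‖`, where `n ‖Δₙ‖² → ∞`. -/
theorem ErrorAssumption.tendsto_measure_sq_norm_sum_gt [CompleteSpace H] [IsProbabilityMeasure P]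
    (hε : ErrorAssumption P ε) {D : ℕ → ℝ} (hD : Tendsto D atTop atTop) (a : ℕ → ℕ → ℝ) (A : ℝ)
    (ha : ∀ᶠ n in atTop, ∀ i ∈ Finset.Icc 1 n, |a n i| ≤ A) {ρ : ℝ} (hρ : 0 < ρ) :
    Tendsto (fun n : ℕ => P {ω | n * D n * ρ ≤ ‖∑ i ∈ Finset.Icc 1 n, a n i • ε i ω‖ ^ 2}) atTop
      (𝓝 0) := by
  obtain ⟨K, hK, hKb⟩ := hε.exists_lintegral_sq_norm_sum_le
  have hlim : Tendsto (fun n => ENNReal.ofReal (A ^ 2 * K / ρ / D n)) atTop (𝓝 0) := by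
    have := ENNReal.tendsto_ofReal (hD.const_div_atTop (A ^ 2 * K / ρ))
    simpa using this
  refine tendsto_of_tendsto_of_tendsto_of_le_of_le' tendsto_const_nhds hlim
    (Eventually.of_forall fun _ => zero_le) ?_
  filter_upwards [ha, hD.eventually_gt_atTop 0, eventually_gt_atTop 0] with n hn hDn h0
  have hn0 : (0 : ℝ) < n := by exact_mod_cast h0
  have hc : 0 < n * D n * ρ := by positivity
  have hmeas : Measurable fun ω => ENNReal.ofReal (‖∑ i ∈ Finset.Icc 1 n, a n i • ε i ω‖ ^ 2) := by
    have := hε.measurable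
    fun_prop
  calc P {ω | n * D n * ρ ≤ ‖∑ i ∈ Finset.Icc 1 n, a n i • ε i ω‖ ^ 2}
      ≤ P {ω | ENNReal.ofReal (n * D n * ρ) ≤
          ENNReal.ofReal (‖∑ i ∈ Finset.Icc 1 n, a n i • ε i ω‖ ^ 2)} :=
        measure_mono fun ω hω => ENNReal.ofReal_le_ofReal hω
    _ ≤ (∫⁻ ω, ENNReal.ofReal (‖∑ i ∈ Finset.Icc 1 n, a n i • ε i ω‖ ^ 2) ∂P) /
          ENNReal.ofReal (n * D n * ρ) :=
        meas_ge_le_lintegral_div hmeas.aemeasurable (by simpa using hc) ENNReal.ofReal_ne_top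
    _ ≤ ENNReal.ofReal (n * A ^ 2 * K) / ENNReal.ofReal (n * D n * ρ) := by
        gcongr
        exact hKb n (a n) A hn
    _ = ENNReal.ofReal (A ^ 2 * K / ρ / D n) := by
        rw [← ENNReal.ofReal_div_of_pos hc]
        congr 1
        field_simp

end Noise

/-! ### The test statistic -/

section Statistic

variable {H : Type*} [NormedAddCommGroup H] [InnerProductSpace ℝ H] {d : ℕ}

theorem IsLeadingEigensystem.eigenvalue_le_norm [CompleteSpace H] {C : H →L[ℝ] H} {l : Fin d → ℝ}
    {v : Fin d → H} (hC : IsLeadingEigensystem C l v) (p : Fin d) : l p ≤ ‖C‖ := by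
  have h1 := C.le_opNorm (v p)
  rw [hC.eigen, norm_smul, hC.orthonormal.1, mul_one, mul_one] at h1
  exact (le_abs_self _).trans h1

theorem sum_sq_inner_le_sq_norm {v : Fin d → H} (hv : Orthonormal ℝ v) (x : H) :
    ∑ p, ⟪x, v p⟫ ^ 2 ≤ ‖x‖ ^ 2 := by
  simpa [real_inner_comm] using hv.sum_inner_products_le (x := x) (s := Finset.univ)

/-- The sign is `±1` here: were it `0`, the distance would be `‖u‖ = 1`. -/
theorem sq_inner_ge_of_norm_sub_sign_le {u w x : H} {δ : ℝ} (hu : ‖u‖ = 1) (hδ : δ < 1)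
    (huw : ‖u - Real.sign ⟪u, w⟫ • w‖ ≤ δ) :
    ⟪x, w⟫ ^ 2 / 2 - δ ^ 2 * ‖x‖ ^ 2 ≤ ⟪x, u⟫ ^ 2 := by
  set s := Real.sign ⟪u, w⟫ with hs
  have hs2 : s ^ 2 = 1 := by
    rcases Real.sign_apply_eq ⟪u, w⟫ with h | h | h
    · rw [hs, h]; norm_num
    · rw [hs, h, zero_smul, sub_zero, hu] at huw
      linarith
    · rw [hs, h]; norm_num
  have hdec : ⟪x, u⟫ = s * ⟪x, w⟫ + ⟪x, u - s • w⟫ := by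
    rw [inner_sub_right, real_inner_smul_right]
    ring
  have hrem : ⟪x, u - s • w⟫ ^ 2 ≤ δ ^ 2 * ‖x‖ ^ 2 := by
    rw [← sq_abs, ← mul_pow]
    refine pow_le_pow_left₀ (abs_nonneg _) ((abs_real_inner_le_norm _ _).trans ?_) 2
    rw [mul_comm]
    exact mul_le_mul_of_nonneg_right huw (norm_nonneg _)
  rw [hdec]
  nlinarith [sq_nonneg (s * ⟪x, w⟫ + 2 * ⟪x, u - s • w⟫)]

theorem le_gradualPCSq (h : ℝ → ℝ) {n k : ℕ} (hk : 1 ≤ k ∧ k < n) (x : ℕ → H) (l : Fin d → ℝ)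
    (v : Fin d → H) :
    ∑ p : Fin d, 1 / l p * (1 / (n : ℝ)) *
      (∑ i ∈ Finset.Icc 1 n, centeredWeight h n k i * ⟪x i, v p⟫) ^ 2 ≤ gradualPCSq h n x l v := by
  simp only [centeredWeight, ← sum_mul_sub_average]
  exact le_ciSup (f := fun k : Set.Ico 1 n => ∑ p : Fin d, 1 / l p * (1 / (n : ℝ)) *
    (∑ i ∈ Finset.Icc 1 n, h (((i : ℝ) - (k : ℕ)) / n) *
      (⟪x i, v p⟫ - 1 / (n : ℝ) * ∑ j ∈ Finset.Icc 1 n, ⟪x j, v p⟫)) ^ 2)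
    (Set.finite_range _).bddAbove ⟨k, hk⟩

/-- Under the local model the mean drops out and the score of the sample splits into a signal and
a noise part. -/
theorem sum_centeredWeight_mul_inner (h g : ℝ → ℝ) {n : ℕ} (hn : 0 < n) (k : ℕ) {x e : ℕ → H}
    {m D : H} (hx : ∀ i, 1 ≤ i → i ≤ n → x i = m + g ((i : ℝ) / n) • D + e i) (u : H) :
    ∑ i ∈ Finset.Icc 1 n, centeredWeight h n k i * ⟪x i, u⟫ =
      (∑ i ∈ Finset.Icc 1 n, centeredWeight h n k i * g ((i : ℝ) / n)) * ⟪D, u⟫ +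
        ⟪∑ i ∈ Finset.Icc 1 n, centeredWeight h n k i • e i, u⟫ := by
  have h1 : ∀ i ∈ Finset.Icc 1 n, centeredWeight h n k i * ⟪x i, u⟫ =
      centeredWeight h n k i * ⟪m, u⟫ + centeredWeight h n k i * g ((i : ℝ) / n) * ⟪D, u⟫ +
        ⟪centeredWeight h n k i • e i, u⟫ := fun i hi => by
    rw [hx i (Finset.mem_Icc.1 hi).1 (Finset.mem_Icc.1 hi).2, inner_add_left, inner_add_left,
      real_inner_smul_left, real_inner_smul_left]
    ring
  rw [Finset.sum_congr rfl h1, Finset.sum_add_distrib, Finset.sum_add_distrib, ← Finset.sum_mul,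
    ← Finset.sum_mul, sum_centeredWeight h hn, zero_mul, zero_add, sum_inner]

/-- The deterministic core of the consistency proof: on the event where the estimated
eigenvectors are close to `v'`, the signal sum is at least `n s`, and the noise sum is small, the
squared statistic exceeds every bound as the ratio `‖C‖ / (n ‖D‖²)` tends to `0`. -/
theorem le_gradualPCSq_of_signal_of_noise [CompleteSpace H] {h g : ℝ → ℝ} {n k : ℕ}
    (hk : 1 ≤ k ∧ k < n) {x e : ℕ → H} {m D : H}
    (hx : ∀ i, 1 ≤ i → i ≤ n → x i = m + g ((i : ℝ) / n) • D + e i)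
    {C : H →L[ℝ] H} {l : Fin d → ℝ} {v v' : Fin d → H} (hC : IsLeadingEigensystem C l v)
    (hl : ∀ p, 0 < l p) {c δ s η : ℝ} (hc : 0 < c) (hD : 0 < ‖D‖)
    (hproj : c * ‖D‖ ^ 2 ≤ ∑ p, ⟪D, v' p⟫ ^ 2)
    (hδ1 : δ < 1) (hδ : d * δ ^ 2 ≤ c / 4)
    (hv : ∀ p, ‖v p - Real.sign ⟪v p, v' p⟫ • v' p‖ ≤ δ)
    (hs : (n * s) ^ 2 ≤
      (∑ i ∈ Finset.Icc 1 n, centeredWeight h n k i * g ((i : ℝ) / n)) ^ 2)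
    (hN : ‖∑ i ∈ Finset.Icc 1 n, centeredWeight h n k i • e i‖ ^ 2 ≤
      n * (n * ‖D‖ ^ 2) * (s ^ 2 * c / 16))
    (hη : 0 < η) (hCη : ‖C‖ ≤ η * (n * ‖D‖ ^ 2)) :
    s ^ 2 * c / 16 / η ≤ gradualPCSq h n x l v := by
  have hn : 0 < n := by omega
  have hn' : (0 : ℝ) < n := by exact_mod_cast hn
  refine le_trans ?_ (le_gradualPCSq h hk x l v)
  simp only [sum_centeredWeight_mul_inner h g hn k hx]
  set S := ∑ i ∈ Finset.Icc 1 n, centeredWeight h n k i * g ((i : ℝ) / n) with hS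
  set N := ∑ i ∈ Finset.Icc 1 n, centeredWeight h n k i • e i with hNdef
  have hDv : c / 4 * ‖D‖ ^ 2 ≤ ∑ p, ⟪D, v p⟫ ^ 2 := by
    have h1 := Finset.sum_le_sum fun p (_ : p ∈ Finset.univ) =>
      sq_inner_ge_of_norm_sub_sign_le (x := D) (hC.orthonormal.1 p) hδ1 (hv p)
    rw [Finset.sum_sub_distrib, ← Finset.sum_div] at h1
    simp only [Finset.sum_const, Finset.card_univ, Fintype.card_fin, nsmul_eq_mul] at h1
    nlinarith [mul_le_mul_of_nonneg_right hδ (sq_nonneg ‖D‖)]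
  have hsum : n * (n * ‖D‖ ^ 2) * (s ^ 2 * c / 16) ≤ ∑ p, (S * ⟪D, v p⟫ + ⟪N, v p⟫) ^ 2 := by
    have h1 : ∑ p, (S ^ 2 / 2 * ⟪D, v p⟫ ^ 2 - ⟪N, v p⟫ ^ 2) ≤
        ∑ p, (S * ⟪D, v p⟫ + ⟪N, v p⟫) ^ 2 := Finset.sum_le_sum fun p _ => by
      nlinarith [sq_nonneg (S * ⟪D, v p⟫ + 2 * ⟪N, v p⟫)]
    rw [Finset.sum_sub_distrib, ← Finset.mul_sum] at h1
    have h2 := sum_sq_inner_le_sq_norm hC.orthonormal N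
    have h3 : (n * s) ^ 2 / 2 * (c / 4 * ‖D‖ ^ 2) ≤ S ^ 2 / 2 * ∑ p, ⟪D, v p⟫ ^ 2 :=
      mul_le_mul (by linarith) hDv (by positivity) (by positivity)
    linarith
  -- The lower bound on the projection of `D ≠ 0` forces `d ≥ 1`, hence `‖C‖ > 0`.
  have hCpos : 0 < ‖C‖ := by
    have h1 : 0 < ∑ p, ⟪D, v p⟫ ^ 2 := lt_of_lt_of_le (by positivity) hDv
    obtain ⟨p, -, -⟩ := Finset.exists_ne_zero_of_sum_ne_zero h1.ne'
    exact (hl p).trans_le (hC.eigenvalue_le_norm p)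
  calc s ^ 2 * c / 16 / η
      = 1 / (η * (n * ‖D‖ ^ 2)) * (1 / (n : ℝ)) * (n * (n * ‖D‖ ^ 2) * (s ^ 2 * c / 16)) := by
        field_simp
    _ ≤ 1 / ‖C‖ * (1 / (n : ℝ)) * ∑ p, (S * ⟪D, v p⟫ + ⟪N, v p⟫) ^ 2 := by
        gcongr
    _ ≤ ∑ p, 1 / l p * (1 / (n : ℝ)) * (S * ⟪D, v p⟫ + ⟪N, v p⟫) ^ 2 := by
        rw [Finset.mul_sum]
        refine Finset.sum_le_sum fun p _ => ?_
        have := hl p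
        have := hC.eigenvalue_le_norm p
        gcongr

variable [CompleteSpace H] [MeasurableSpace H] [BorelSpace H] [SecondCountableTopology H]
variable {Ω : Type*} [MeasurableSpace Ω]

theorem tendstoInfinityInProbability_gradualPC (P : Measure Ω) [IsProbabilityMeasure P]
    {ε : ℤ → Ω → H} {μ : H} {Δ : ℕ → H} {g h : ℝ → ℝ} {X : ℕ → ℕ → Ω → H}
    (hX : FollowsLocalModel X μ Δ g ε) (hg : IsChangeFunction g)
    (hΔ : Tendsto (fun n : ℕ => (n : ℝ) * ‖Δ n‖ ^ 2) atTop atTop) (hε : ErrorAssumption P ε)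
    {C : ℕ → Ω → H →L[ℝ] H} {l : ℕ → Ω → Fin d → ℝ} {v : ℕ → Ω → Fin d → H}
    (heig : ∀ n, ∀ᵐ ω ∂P, IsLeadingEigensystem (C n ω) (l n ω) (v n ω))
    (hpos : ∀ p, Tendsto (fun n => P {ω | l n ω p ≤ 0}) atTop (𝓝 0))
    (hC : TendstoInMeasure P (fun (n : ℕ) ω => ‖C n ω‖ / ((n : ℝ) * ‖Δ n‖ ^ 2)) atTop
      (fun _ => (0 : ℝ)))
    {v' : Fin d → H}
    (hv : ∀ p, TendstoInMeasure P
      (fun (n : ℕ) ω => ‖v n ω p - Real.sign ⟪v n ω p, v' p⟫ • v' p‖) atTop (fun _ => (0 : ℝ)))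
    {c : ℝ} (hc : 0 < c) (hc1 : c ≤ 1)
    (hproj : ∀ n : ℕ, 1 ≤ n → c * ‖Δ n‖ ^ 2 ≤ ∑ p : Fin d, ⟪Δ n, v' p⟫ ^ 2)
    (hh : IsWeightFunction h) (hdet : IsDetectable h g) :
    TendstoInfinityInProbability P
      (fun n ω => gradualPC h n (fun i => X n i ω) (l n ω) (v n ω)) := by
  intro M
  -- A point `t` where the signal is nonzero, and candidate change points `kₙ` with `kₙ / n → t`:
  -- the maximum is bounded below by its term at the deterministic index `kₙ`.
  obtain ⟨t, ht, hsig⟩ := hdet.exists_signal_ne_zero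
  obtain ⟨k, hk, hkt⟩ := exists_tendsto_div ht
  have hkn : ∀ᶠ n in atTop, k n ≤ n := by
    filter_upwards [eventually_ge_atTop 2] with n hn using (hk n hn).2.le
  obtain ⟨B, -, hB⟩ := hh.bounded
  set s := |signal h g t| / 2 with hs
  have hs0 : 0 < s := by positivity
  set δ := c / (4 * (d + 1)) with hδ
  have hδ0 : 0 < δ := by positivity
  have hδ1 : δ < 1 := by
    rw [hδ, div_lt_one (by positivity)]
    linarith [Nat.cast_nonneg (α := ℝ) d]
  have hδd : d * δ ^ 2 ≤ c / 4 := by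
    have h1 : (d + 1) * δ = c / 4 := by rw [hδ]; field_simp
    nlinarith [Nat.cast_nonneg (α := ℝ) d]
  -- Chosen so that the lower bound on the squared statistic becomes `M ^ 2 + 1`.
  set η := s ^ 2 * c / 16 / (M ^ 2 + 1) with hη
  have hη0 : 0 < η := by positivity
  have hN := hε.tendsto_measure_sq_norm_sum_gt hΔ (fun n => centeredWeight h n (k n)) (2 * B) (by
    filter_upwards [hkn, eventually_gt_atTop 0] with n h1 h2 i hi
    exact abs_centeredWeight_le hB h2 h1 (Finset.mem_Icc.1 hi).2)
    (ρ := s ^ 2 * c / 16) (by positivity)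
  have hS : ∀ᶠ n : ℕ in atTop, (n * s) ^ 2 ≤
      (∑ i ∈ Finset.Icc 1 n, centeredWeight h n (k n) i * g ((i : ℝ) / n)) ^ 2 := by
    have h1 := (tendsto_sum_centeredWeight_mul hh hg ht hkn hkt).abs
    have h2 : s < |signal h g t| := by
      rw [hs]; exact half_lt_self (abs_pos.2 hsig)
    filter_upwards [h1.eventually_const_lt h2, eventually_gt_atTop 0] with n hn h0
    have hn' : (0 : ℝ) < n := by exact_mod_cast h0
    rw [abs_mul, abs_of_pos (by positivity : 0 < 1 / (n : ℝ)), one_div, lt_inv_mul_iff₀ hn'] at hn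
    rw [← sq_abs (∑ i ∈ _, _)]
    exact pow_le_pow_left₀ (by positivity) hn.le 2
  have hCn := tendstoInMeasure_iff_norm.1 hC η hη0
  have hvn := fun p => tendstoInMeasure_iff_norm.1 (hv p) δ hδ0
  have hlim := (((tendsto_finsetSum Finset.univ fun p _ => hpos p).add
    (tendsto_finsetSum Finset.univ fun p _ => hvn p)).add hCn).add hN
  simp only [Finset.sum_const_zero, add_zero] at hlim
  refine tendsto_of_tendsto_of_tendsto_of_le_of_le' tendsto_const_nhds hlim
    (Eventually.of_forall fun _ => zero_le) ?_
  filter_upwards [hS, hΔ.eventually_gt_atTop 0, eventually_ge_atTop 2] with n hSn hDn hn2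
  have hD : 0 < ‖Δ n‖ := by
    refine (norm_nonneg _).lt_of_ne fun h0 => ?_
    rw [← h0] at hDn
    simp at hDn
  refine (measure_mono_ae (t := (((⋃ p, {ω | l n ω p ≤ 0}) ∪
    ⋃ p, {ω | δ ≤ ‖‖v n ω p - Real.sign ⟪v n ω p, v' p⟫ • v' p‖ - 0‖}) ∪
    {ω | η ≤ ‖‖C n ω‖ / ((n : ℝ) * ‖Δ n‖ ^ 2) - 0‖}) ∪
    {ω | n * (n * ‖Δ n‖ ^ 2) * (s ^ 2 * c / 16) ≤
      ‖∑ i ∈ Finset.Icc 1 n, centeredWeight h n (k n) i • ε i ω‖ ^ 2}) ?_).trans ?_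
  · filter_upwards [heig n] with ω hω hT
    by_contra hcon
    change ω ∉ (_ : Set Ω) at hcon
    simp only [Set.mem_union, Set.mem_iUnion, Set.mem_ofPred_eq, not_or, not_exists, not_le,
      sub_zero, norm_norm] at hcon
    obtain ⟨⟨⟨hl, hvω⟩, hCω⟩, hNω⟩ := hcon
    rw [Real.norm_of_nonneg (by positivity), div_lt_iff₀ hDn] at hCω
    have hlow := le_gradualPCSq_of_signal_of_noise (hk n hn2) (e := fun i => ε i ω)
      (fun i hi1 hin => hX n i hi1 hin ω) hω hl hc hD (hproj n (by omega)) hδ1 hδd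
      (fun p => (hvω p).le) hSn hNω.le hη0 hCω.le
    have h1 : s ^ 2 * c / 16 / η = M ^ 2 + 1 := by
      rw [hη]; field_simp
    rw [h1] at hlow
    have hTM : gradualPC h n (fun i => X n i ω) (l n ω) (v n ω) ≤ M := hT
    rw [gradualPC] at hTM
    have h2 : |M| < √(gradualPCSq h n (fun i => X n i ω) (l n ω) (v n ω)) := by
      refine Real.lt_sqrt_of_sq_lt ?_
      rw [sq_abs]
      linarith
    linarith [le_abs_self M]
  · refine (measure_union_le _ _).trans (add_le_add ?_ le_rfl)
    refine (measure_union_le _ _).trans (add_le_add ?_ le_rfl)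
    refine (measure_union_le _ _).trans (add_le_add ?_ ?_)
    · exact measure_iUnion_fintype_le _ _
    · exact measure_iUnion_fintype_le _ _

end Statistic

end GradualChange

theorem mainTheorem7
    {Z : Type*} [MeasurableSpace Z] (ν : Measure Z) [SigmaFinite ν]
    [TopologicalSpace.SeparableSpace (Lp ℝ 2 ν)]
    [MeasurableSpace (Lp ℝ 2 ν)] [BorelSpace (Lp ℝ 2 ν)]
    {Ω : Type*} [MeasurableSpace Ω] (P : Measure Ω) [IsProbabilityMeasure P]
    {Ω' : Type*} [MeasurableSpace Ω'] (P' : Measure Ω') [IsProbabilityMeasure P']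
    -- the model
    (ε : ℤ → Ω → Lp ℝ 2 ν) (μ : Lp ℝ 2 ν) (Δ : ℕ → Lp ℝ 2 ν) (g h : ℝ → ℝ)
    (X : ℕ → ℕ → Ω → Lp ℝ 2 ν)
    (hX : FollowsLocalModel X μ Δ g ε)
    (hg : IsChangeFunction g)
    (hΔ : Tendsto (fun n : ℕ => (n : ℝ) * ‖Δ n‖ ^ 2) atTop atTop)
    -- the errors
    (hε : ErrorAssumption P ε)
    (W : Ω' → Cadlag (Lp ℝ 2 ν)) (hFCLT : SatisfiesFCLT P ε P' W)
    -- the estimated covariance operator and its leading eigenvalues and eigenfunctions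
    (d : ℕ) (C : ℕ → Ω → Lp ℝ 2 ν →L[ℝ] Lp ℝ 2 ν)
    (l : ℕ → Ω → Fin d → ℝ) (v : ℕ → Ω → Fin d → Lp ℝ 2 ν)
    (heig : ∀ n, ∀ᵐ ω ∂P, IsLeadingEigensystem (C n ω) (l n ω) (v n ω))
    (hpos : ∀ p, Tendsto (fun n => P {ω | l n ω p ≤ 0}) atTop (𝓝 0))
    (hC : TendstoInMeasure P (fun (n : ℕ) ω => ‖C n ω‖ / ((n : ℝ) * ‖Δ n‖ ^ 2)) atTop
      (fun _ => (0 : ℝ)))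
    -- the limiting eigenfunctions
    (v' : Fin d → Lp ℝ 2 ν) (hv' : Orthonormal ℝ v')
    (hv : ∀ p, TendstoInMeasure P
      (fun (n : ℕ) ω => ‖v n ω p - Real.sign (inner ℝ (v n ω p) (v' p)) • v' p‖) atTop
      (fun _ => (0 : ℝ)))
    (hproj : ∃ c : ℝ, 0 < c ∧ c ≤ 1 ∧
      ∀ n : ℕ, 1 ≤ n → c * ‖Δ n‖ ^ 2 ≤ ∑ p : Fin d, (inner ℝ (Δ n) (v' p)) ^ 2)
    -- the weight function
    (hh : IsWeightFunction h) (hdet : IsDetectable h g) :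
    TendstoInfinityInProbability P
      (fun n ω => gradualPC h n (fun i => X n i ω) (l n ω) (v n ω)) := by
  have : SecondCountableTopology (Lp ℝ 2 ν) := UniformSpace.secondCountable_of_separable _
  obtain ⟨c, hc, hc1, hproj⟩ := hproj
  exact tendstoInfinityInProbability_gradualPC P hX hg hΔ hε heig hpos hC hv hc hc1 hproj hh hdet
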